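/- Let $n\in\mathbb{N}$, let $I\subseteq\mathbb{R}$ be an open interval, and let $f:I\to\mathbb{R}$ be $n$-Wright convex, i.e. $$\Delta_{h_1}\cdots\Delta_{h_{n+1}} f(x)\ge 0\quad\text{whenever } h_1,\dots,h_{n+1}>0,\ x\in I,\ x+h_1+\dots+h_{n+1}\in I,$$ where $\Delta_h f(x)=f(x+h)-f(x)$. Then there exist a function $g:I\to\mathbb{R}$ and a function $P:\mathbb{R}\to\mathbb{R}$ such that $f(x)=g(x)+P(x)$ for all $x\in I$, where: * $g$ is $n$-convex on $I$ (in the sense of Popoviciu), i.e. for all pairwise distinct $x_0,\dots,x_{n+1}\in I$, $$[x_0,\dots,x_{n+1};g]:=\sum_{i=0}^{n+1}\frac{g(x_i)}{\prod_{j\ne i}(x_i-x_j)}\ge 0;$$ * $P$ is a polynomial function of degree at most $n$, i.e. there are a constant $a_0\in\mathbb{R}$ and, for each $k=1,\dots,n$, a symmetric map $A_k:\mathbb{R}^k\to\mathbb{R}$ that is additive in each variable, such that $P(x)=a_0+\sum_{k=1}^n A_k(x,\dots,x)$ for all $x\in\mathbb{R}$. -/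

import Mathlib

open scoped BigOperators

/-- `Δ_{h 0} ⋯ Δ_{h (m-1)} f`, where `Δ_h f x = f (x + h) - f x`. -/
def iterDiff {m : ℕ} (h : Fin m → ℝ) (f : ℝ → ℝ) : ℝ → ℝ :=
  (List.ofFn h).foldr fwdDiff f

/-- `f` is Wright convex of order `n` on `I`. For an interval `I`, the inequality below involves
only values of `f` at points of `I`, since `x` and `x + h 0 + ⋯ + h n` lie in `I`. -/
def WrightConvexOn (n : ℕ) (I : Set ℝ) (f : ℝ → ℝ) : Prop :=
  ∀ h : Fin (n + 1) → ℝ, (∀ i, 0 < h i) →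
    ∀ x ∈ I, x + ∑ i, h i ∈ I → 0 ≤ iterDiff h f x

/-- The divided difference `[x 0, …, x (m-1); f]` (meant for pairwise distinct points). -/
noncomputable def dividedDiff {m : ℕ} (x : Fin m → ℝ) (f : ℝ → ℝ) : ℝ :=
  ∑ i, f (x i) / ∏ j ∈ Finset.univ.erase i, (x i - x j)

/-- `f` is convex of order `n` on `I` (Popoviciu): all its divided differences at `n + 2` pairwise
distinct points of `I` are nonnegative. -/
def HigherConvexOn (n : ℕ) (I : Set ℝ) (f : ℝ → ℝ) : Prop :=
  ∀ x : Fin (n + 2) → ℝ, Function.Injective x → (∀ i, x i ∈ I) → 0 ≤ dividedDiff x f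

/-- `P : ℝ → ℝ` is a polynomial function of degree at most `n`: a constant plus the
diagonalizations of symmetric `k`-additive maps `A k : ℝ^k → ℝ`, `k = 1, …, n`.
A `k`-additive map is the same thing as a `ℤ`-multilinear map. -/
def IsPolynomialFunction (n : ℕ) (P : ℝ → ℝ) : Prop :=
  ∃ (a₀ : ℝ) (A : (k : ℕ) → MultilinearMap ℤ (fun _ : Fin k => ℝ) ℝ),
    (∀ (k : ℕ) (σ : Equiv.Perm (Fin k)) (v : Fin k → ℝ), A k (fun i => v (σ i)) = A k v) ∧
    ∀ x : ℝ, P x = a₀ + ∑ k ∈ Finset.Icc 1 n, A k (fun _ => x)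

/-! For `n = 0` the function `f` is nondecreasing, and `g = f`, `P = 0` work. Let `n ≥ 1`.

With equal increments, the Wright inequality says that divided differences at `n + 2` consecutive
nodes of an arithmetic progression are nonnegative. Inserting nodes extends this to any `n + 2`
points of `I` in one coset `p + ℚ` (`divDiff_nonneg_of_mem_coset`). Hence `f` restricted to a coset
is locally a Lipschitz function times a polynomial and extends continuously to `I`
(`exists_continuousOn_extension`). Let `g` be the extension from `ℚ` itself; it is `n`-convex by
density (`HigherConvexOn.of_coset`).

Put `c = f - g`, which vanishes at the rational points of `I`. The differences of `f` of order `n`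
are nondecreasing in the base point and continuous along rational displacements, hence continuous
(`continuousAt_iterDiff_of_wrightConvexOn`); so are those of `c`. Approximating the increments by
rationals one at a time, then the base point, shows that the differences of `c` of order `n + 1`
vanish (`iterDiff_succ_eq_zero`). A local version of Fréchet's theorem
(`exists_isPolynomialFunction`) turns `c` into a polynomial function. -/

open Filter Topology

/-! ### Divided differences, and their sign at nodes of an arithmetic progression -/

section DividedDifference
variable {ι : Type*} [DecidableEq ι]

/-- The divided difference of the values `f` at the nodes `v i`, `i ∈ s`. -/
noncomputable def divDiff (s : Finset ι) (v f : ι → ℝ) : ℝ :=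
  ∑ i ∈ s, f i / ∏ j ∈ s.erase i, (v i - v j)

theorem divDiff_insert {s : Finset ι} {a : ι} (ha : a ∉ s) (v f : ι → ℝ) :
    divDiff (insert a s) v f =
      f a / ∏ j ∈ s, (v a - v j) +
        ∑ i ∈ s, f i / ((v i - v a) * ∏ j ∈ s.erase i, (v i - v j)) := by
  rw [divDiff, Finset.sum_insert ha, Finset.erase_insert ha]
  congr 1
  refine Finset.sum_congr rfl fun i hi => ?_
  have hia : i ≠ a := fun h => ha (h ▸ hi)
  rw [Finset.erase_insert_of_ne hia.symm, Finset.prod_insert (by simp [ha])]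

theorem divDiff_insert_insert {s : Finset ι} {a b : ι} (hab : a ≠ b) (ha : a ∉ s) (hb : b ∉ s)
    (v f : ι → ℝ) :
    divDiff (insert a (insert b s)) v f =
      f a / ((v a - v b) * ∏ j ∈ s, (v a - v j)) +
      f b / ((v b - v a) * ∏ j ∈ s, (v b - v j)) +
        ∑ i ∈ s, f i / ((v i - v a) * ((v i - v b) * ∏ j ∈ s.erase i, (v i - v j))) := by
  rw [divDiff_insert (by simp [hab, ha]), Finset.prod_insert hb, Finset.sum_insert hb,
    Finset.erase_insert hb, add_assoc]
  congr 2
  refine Finset.sum_congr rfl fun i hi => ?_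
  have hib : i ≠ b := fun h => hb (h ▸ hi)
  rw [Finset.erase_insert_of_ne hib.symm, Finset.prod_insert (by simp [hb])]

/-- The symmetric form of the divided difference recurrence; the comparisons of divided differences
below all come from it. -/
theorem divDiff_exchange {s : Finset ι} {a b : ι} (hab : a ≠ b) (ha : a ∉ s) (hb : b ∉ s)
    {v : ι → ℝ} (hv : Function.Injective v) (f : ι → ℝ) :
    divDiff (insert a s) v f - divDiff (insert b s) v f =
      (v a - v b) * divDiff (insert a (insert b s)) v f := by
  have hne : ∀ {i j}, i ≠ j → v i - v j ≠ 0 := fun h => sub_ne_zero.2 (hv.ne h)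
  rw [divDiff_insert ha, divDiff_insert hb, divDiff_insert_insert hab ha hb, mul_add, mul_add,
    Finset.mul_sum, add_sub_add_comm, ← Finset.sum_sub_distrib]
  have h1 := hne hab
  have h2 := hne hab.symm
  have hA : ∏ j ∈ s, (v a - v j) ≠ 0 :=
    Finset.prod_ne_zero_iff.2 fun j hj => hne fun h => ha (h ▸ hj)
  have hB : ∏ j ∈ s, (v b - v j) ≠ 0 :=
    Finset.prod_ne_zero_iff.2 fun j hj => hne fun h => hb (h ▸ hj)
  congr 1
  · rw [← neg_sub (v a) (v b)]
    field_simp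
    ring
  · refine Finset.sum_congr rfl fun i hi => ?_
    have h3 := hne (i := i) (j := a) fun h => ha (h ▸ hi)
    have h4 := hne (i := i) (j := b) fun h => hb (h ▸ hi)
    have hC : ∏ j ∈ s.erase i, (v i - v j) ≠ 0 :=
      Finset.prod_ne_zero_iff.2 fun j hj => hne (Finset.ne_of_mem_erase hj).symm
    field_simp
    ring

theorem divDiff_image {κ : Type*} [DecidableEq κ] {e : κ → ι} (he : Function.Injective e)
    (s : Finset κ) (v f : ι → ℝ) :
    divDiff (s.image e) v f = divDiff s (v ∘ e) (f ∘ e) := by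
  rw [divDiff, Finset.sum_image he.injOn]
  refine Finset.sum_congr rfl fun i _ => ?_
  rw [← Finset.image_erase he, Finset.prod_image he.injOn]
  rfl

/-- Two exchange identities share the difference at all of `a`, `b`, `t`, `s`. Eliminating it
exhibits the difference at `a`, `b`, `s` as a convex combination of the two given ones. -/
theorem divDiff_nonneg_of_between {s : Finset ι} {a b t : ι} (hab : a ≠ b) (hta : t ≠ a)
    (htb : t ≠ b) (ha : a ∉ s) (hb : b ∉ s) (ht : t ∉ s) {v : ι → ℝ}
    (hv : Function.Injective v) (f : ι → ℝ) (hat : v a < v t) (hbt : v t < v b)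
    (h1 : 0 ≤ divDiff (insert t (insert a s)) v f)
    (h2 : 0 ≤ divDiff (insert t (insert b s)) v f) :
    0 ≤ divDiff (insert a (insert b s)) v f := by
  have e1 := divDiff_exchange (s := insert a s) htb (by simp [hta, ht]) (by simp [hab.symm, hb])
    hv f
  have e2 := divDiff_exchange (s := insert b s) hta (by simp [htb, ht]) (by simp [hab, ha])
    hv f
  have e3 : insert t (insert b (insert a s)) = insert t (insert a (insert b s)) := by
    rw [Finset.insert_comm b a]
  rw [e3, Finset.insert_comm b a] at e1
  set x := divDiff (insert a (insert b s)) v f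
  set y := divDiff (insert t (insert a (insert b s))) v f
  have : (v b - v a) * x = (v t - v a) * divDiff (insert t (insert a s)) v f +
      (v b - v t) * divDiff (insert t (insert b s)) v f := by
    linear_combination (v a - v t) * e1 - (v b - v t) * e2
  have hpos : 0 < v b - v a := by linarith
  refine nonneg_of_mul_nonneg_right (a := v b - v a) ?_ hpos
  rw [this]
  have := mul_nonneg (sub_nonneg.2 hat.le) h1
  have := mul_nonneg (sub_nonneg.2 hbt.le) h2
  linarith

/-- Induction on the length `d` of a window containing `s`. If an end of the window is not in `s`,
the window shrinks. If both ends are in `s` but some `t` between them is not, replacing either end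
by `t` gives two sets in shorter windows. Otherwise `s` is a block of consecutive nodes. -/
theorem divDiff_nonneg_of_consecutive {m : ℕ} {v : ℤ → ℝ} (hv : StrictMono v) (r : ℤ → ℝ)
    {lo hi : ℤ}
    (h : ∀ k, lo ≤ k → k + m ≤ hi → 0 ≤ divDiff (Finset.Icc k (k + m)) v r) (d : ℕ) :
    ∀ (k : ℤ) (s : Finset ℤ), s ⊆ Finset.Icc k (k + d) → lo ≤ k → k + d ≤ hi →
      s.card = m + 1 → 0 ≤ divDiff s v r := by
  have full : ∀ (d : ℕ) (k : ℤ), lo ≤ k → k + d ≤ hi → (Finset.Icc k (k + d)).card = m + 1 →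
      0 ≤ divDiff (Finset.Icc k (k + d)) v r := by
    intro d k h1 h2 h3
    rw [Int.card_Icc] at h3
    have : d = m := by omega
    subst this
    exact h k h1 h2
  induction d with
  | zero =>
    intro k s hs h1 h2 hc
    have : s = Finset.Icc k (k + (0 : ℕ)) := by
      refine Finset.eq_of_subset_of_card_le hs ?_
      rw [Int.card_Icc]; omega
    subst this
    exact full 0 k h1 h2 hc
  | succ d ih =>
    intro k s hs h1 h2 hc
    push_cast at hs h2
    by_cases hk : k ∈ s
    swap
    · refine ih (k + 1) s (fun x hx => ?_) (by omega) (by omega) hc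
      have := Finset.mem_Icc.1 (hs hx)
      have : x ≠ k := fun h => hk (h ▸ hx)
      rw [Finset.mem_Icc]; omega
    by_cases hl : k + d + 1 ∈ s
    swap
    · refine ih k s (fun x hx => ?_) (by omega) (by omega) hc
      have := Finset.mem_Icc.1 (hs hx)
      have : x ≠ k + d + 1 := fun h => hl (h ▸ hx)
      rw [Finset.mem_Icc]; omega
    by_cases hall : Finset.Icc k (k + (d + 1)) ⊆ s
    · have := Finset.Subset.antisymm hs hall
      subst this
      exact_mod_cast full (d + 1) k h1 (by exact_mod_cast h2) (by exact_mod_cast hc)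
    obtain ⟨t, ht, hts⟩ := Finset.not_subset.1 hall
    rw [Finset.mem_Icc] at ht
    have htk : t ≠ k := fun h => hts (h ▸ hk)
    have htl : t ≠ k + d + 1 := fun h => hts (h ▸ hl)
    have hkl : k ≠ k + d + 1 := by omega
    obtain ⟨u, hu⟩ : ∃ u, u = (s.erase k).erase (k + d + 1) := ⟨_, rfl⟩
    have hlu : k + d + 1 ∉ u := by simp [hu]
    have hku : k ∉ u := by simp [hu]
    have htu : t ∉ u := by simp [hu, hts]
    have hsu : s = insert k (insert (k + d + 1) u) := by
      rw [hu, Finset.insert_erase (by simp [hl, hkl.symm]), Finset.insert_erase hk]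
    have hcu : u.card + 2 = m + 1 := by
      rw [← hc, hsu, Finset.card_insert_of_notMem (by simp [hkl, hku]),
        Finset.card_insert_of_notMem hlu]
    have hus : ∀ x ∈ u, k < x ∧ x < k + d + 1 := by
      intro x hx
      have h1 : x ≠ k := fun h => hku (h ▸ hx)
      have h2 : x ≠ k + d + 1 := fun h => hlu (h ▸ hx)
      have := Finset.mem_Icc.1 (hs (hsu ▸ Finset.mem_insert_of_mem (Finset.mem_insert_of_mem hx)))
      omega
    rw [hsu]
    refine divDiff_nonneg_of_between hkl htk htl hku hlu htu hv.injective r (hv (by omega))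
      (hv (by omega)) (ih k _ ?_ (by omega) (by omega) ?_) (ih (k + 1) _ ?_ (by omega) (by omega) ?_)
    · intro x hx
      simp only [Finset.mem_insert] at hx
      rw [Finset.mem_Icc]
      rcases hx with rfl | rfl | hx
      · omega
      · omega
      · have := hus x hx; omega
    · rw [Finset.card_insert_of_notMem (by simp [htk, htu]), Finset.card_insert_of_notMem hku, hcu]
    · intro x hx
      simp only [Finset.mem_insert] at hx
      rw [Finset.mem_Icc]
      rcases hx with rfl | rfl | hx
      · omega
      · omega
      · have := hus x hx; omega
    · rw [Finset.card_insert_of_notMem (by simp [htl, htu]), Finset.card_insert_of_notMem hlu, hcu]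

theorem iterDiff_const_succ (m : ℕ) (δ : ℝ) (f : ℝ → ℝ) (x : ℝ) :
    iterDiff (fun _ : Fin (m + 1) => δ) f x =
      iterDiff (fun _ : Fin m => δ) f (x + δ) - iterDiff (fun _ : Fin m => δ) f x := by
  simp only [iterDiff, List.ofFn_succ, List.foldr_cons, fwdDiff]

/-- Passing from `m` to `m + 1`, the exchanged end nodes are `(m + 1) * δ` apart, which accounts for
the factor `m! * δ ^ m`. -/
theorem divDiff_consecutive (f : ℝ → ℝ) {a δ : ℝ} (hδ : 0 < δ) (m : ℕ) (k : ℤ) :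
    divDiff (Finset.Icc k (k + m)) (fun k : ℤ => a + k * δ) (fun k : ℤ => f (a + k * δ)) *
      (m.factorial * δ ^ m) = iterDiff (fun _ : Fin m => δ) f (a + k * δ) := by
  induction m generalizing k with
  | zero => simp [divDiff, iterDiff]
  | succ m ih =>
    have hv : Function.Injective (fun k : ℤ => a + k * δ) := fun i j h => by
      have := mul_right_cancel₀ hδ.ne' (add_left_cancel h)
      exact_mod_cast this
    have e1 : Finset.Icc k (k + (m + 1 : ℕ)) =
        insert (k + m + 1) (insert k (Finset.Icc (k + 1) (k + m))) := by
      ext; simp; omega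
    have e2 : Finset.Icc (k + 1) (k + 1 + m) = insert (k + m + 1) (Finset.Icc (k + 1) (k + m)) := by
      ext; simp; omega
    have e3 : Finset.Icc k (k + m) = insert k (Finset.Icc (k + 1) (k + m)) := by
      ext; simp; omega
    have ex := divDiff_exchange (s := Finset.Icc (k + 1) (k + m)) (a := k + m + 1) (b := k)
      (by omega) (by simp) (by simp) hv (fun k : ℤ => f (a + k * δ))
    rw [← e1, ← e2, ← e3] at ex
    have i1 := ih (k + 1)
    have i2 := ih k
    rw [iterDiff_const_succ, ← i2, show a + k * δ + δ = a + ((k + 1 : ℤ) : ℝ) * δ by push_cast; ring,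
      ← i1, Nat.factorial_succ]
    push_cast at ex ⊢
    linear_combination -(m.factorial * δ ^ m : ℝ) * ex

end DividedDifference

/-! ### Divided differences with nodes in a coset of `ℚ` -/

/-- A common denominator places all nodes on one arithmetic progression, where Wright convexity with
equal increments controls consecutive nodes. -/
theorem divDiff_nonneg_of_mem_coset {n : ℕ} {I : Set ℝ} (hI : I.OrdConnected) {f : ℝ → ℝ}
    (hf : WrightConvexOn n I f) (p : ℝ) (s : Finset ℝ) (hsI : ∀ x ∈ s, x ∈ I)
    (hs : ∀ x ∈ s, ∃ q : ℚ, x = p + q) (hc : s.card = n + 2) : 0 ≤ divDiff s id f := by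
  choose! q hq using hs
  obtain ⟨⟨N, hN0⟩, hN⟩ :=
    IsLocalization.exist_integer_multiples_of_finset (nonZeroDivisors ℤ) (s.image q)
  have hN0 : N ≠ 0 := nonZeroDivisors.ne_zero hN0
  -- The common denominator `N` may be negative, so the step of the progression is `1 / |N|`.
  have key : ∀ x ∈ s, ∃ k : ℤ, x = p + k * (1 / |(N : ℝ)|) := by
    intro x hx
    obtain ⟨k, hk⟩ := hN (q x) (Finset.mem_image_of_mem q hx)
    have hk' : (k : ℝ) = N * q x := by
      have : (k : ℚ) = N * q x := by simpa [zsmul_eq_mul] using hk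
      exact_mod_cast this
    have hNR : (N : ℝ) ≠ 0 := by exact_mod_cast hN0
    rcases abs_choice (N : ℝ) with h | h
    · refine ⟨k, ?_⟩
      rw [h, hk', mul_one_div, mul_div_cancel_left₀ _ hNR]
      exact hq x hx
    · refine ⟨-k, ?_⟩
      push_cast
      rw [h, hk', one_div, inv_neg, neg_mul_neg, mul_right_comm, mul_inv_cancel₀ hNR, one_mul]
      exact hq x hx
  obtain ⟨δ, hδdef⟩ : ∃ δ, δ = 1 / |(N : ℝ)| := ⟨_, rfl⟩
  rw [← hδdef] at key
  have hδ : 0 < δ := by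
    rw [hδdef]
    have : (N : ℝ) ≠ 0 := by exact_mod_cast hN0
    positivity
  choose! k hk using key
  set v : ℤ → ℝ := fun k => p + k * δ with hvdef
  have hv : StrictMono v := fun i j h => by
    have : (i : ℝ) < j := by exact_mod_cast h
    simp only [hvdef]
    nlinarith
  have hs : s = (s.image k).image v := by
    rw [Finset.image_image]
    conv_lhs => rw [← Finset.image_id (s := s)]
    exact Finset.image_congr fun x hx => hk x hx
  have hcard : (s.image k).card = n + 1 + 1 := by
    rw [← hc]
    conv_rhs => rw [hs, Finset.card_image_of_injective _ hv.injective]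
  rw [hs, divDiff_image hv.injective]
  have hne : (s.image k).Nonempty := by rw [← Finset.card_pos]; omega
  set lo := (s.image k).min' hne with hlo
  set hi := (s.image k).max' hne with hhi
  have hmem : ∀ i ∈ s.image k, v i ∈ I := fun i hi => hsI _ (by
    rw [hs]; exact Finset.mem_image_of_mem v hi)
  have hlohi : lo ≤ hi := Finset.min'_le _ _ (Finset.max'_mem _ _)
  have hIcc : ∀ i, lo ≤ i → i ≤ hi → v i ∈ I := fun i h1 h2 =>
    hI.out (hmem _ (Finset.min'_mem _ hne)) (hmem _ (Finset.max'_mem _ hne))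
      ⟨hv.monotone h1, hv.monotone h2⟩
  refine divDiff_nonneg_of_consecutive (m := n + 1) (lo := lo) (hi := hi) hv _ (fun i h1 h2 => ?_)
    (hi - lo).toNat lo _ ?_ le_rfl (by omega) hcard
  · have hD := divDiff_consecutive f (a := p) hδ (n + 1) i
    have h0 := hf (fun _ => δ) (fun _ => hδ) (v i) (hIcc i h1 (by push_cast at h2; omega)) (by
      have : v i + ∑ _i : Fin (n + 1), δ = v (i + (n + 1 : ℕ)) := by
        simp only [hvdef, Finset.sum_const, Finset.card_univ, Fintype.card_fin, nsmul_eq_mul]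
        push_cast; ring
      rw [this]
      exact hIcc _ (by omega) h2)
    have : (0 : ℝ) < (n + 1).factorial * δ ^ (n + 1) := by positivity
    refine nonneg_of_mul_nonneg_left ?_ this
    rw [← hD] at h0
    exact h0
  · intro i hi'
    have h1 := Finset.min'_le _ _ hi'
    have h2 := Finset.le_max' _ _ hi'
    rw [Finset.mem_Icc]
    omega

theorem dividedDiff_eq_divDiff {m : ℕ} {x : Fin m → ℝ} (hx : Function.Injective x) (f : ℝ → ℝ) :
    dividedDiff x f = divDiff (Finset.univ.image x) id f := by
  rw [divDiff_image hx]
  rfl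

theorem infinite_coset_inter_Ioo (p : ℝ) {b c : ℝ} (hbc : b < c) :
    {y : ℝ | (∃ q : ℚ, y = p + q) ∧ b < y ∧ y < c}.Infinite := by
  obtain ⟨q₁, h1, h1'⟩ := exists_rat_btwn (sub_lt_sub_right hbc p)
  obtain ⟨q₂, h2, h2'⟩ := exists_rat_btwn h1'
  have hq : q₁ < q₂ := by exact_mod_cast h2
  have hinj : Function.Injective fun q : ℚ => p + (q : ℝ) := fun a b h => by
    exact_mod_cast add_left_cancel h
  refine ((Set.Ioo_infinite hq).image hinj.injOn).mono ?_
  rintro _ ⟨q, ⟨hq1, hq2⟩, rfl⟩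
  have e1 : (q₁ : ℝ) < q := by exact_mod_cast hq1
  have e2 : (q : ℝ) < q₂ := by exact_mod_cast hq2
  exact ⟨⟨q, rfl⟩, by linarith, by linarith⟩

theorem dense_coset (p : ℝ) : Dense {y : ℝ | ∃ q : ℚ, y = p + q} := by
  rw [dense_iff_exists_between]
  intro a b hab
  obtain ⟨y, hy⟩ := (infinite_coset_inter_Ioo p hab).nonempty
  exact ⟨y, hy⟩

/-! ### Continuous extension from a coset, and its convexity -/

/-- Nonnegativity at `k + 2` nodes makes differences at `k + 1` nodes nondecreasing in each node, by
the exchange identity. -/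
theorem divDiff_insert_le_insert {k : ℕ} {E : Set ℝ} {f : ℝ → ℝ}
    (hE : ∀ s : Finset ℝ, (∀ x ∈ s, x ∈ E) → s.card = k + 2 → 0 ≤ divDiff s id f)
    {s : Finset ℝ} (hs : ∀ x ∈ s, x ∈ E) (hc : s.card = k) {a b : ℝ} (ha : a ∈ E) (hb : b ∈ E)
    (has : a ∉ s) (hbs : b ∉ s) (hba : b < a) :
    divDiff (insert b s) id f ≤ divDiff (insert a s) id f := by
  have h := divDiff_exchange (s := s) hba.ne' has hbs Function.injective_id f
  have h0 : 0 ≤ divDiff (insert a (insert b s)) id f := by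
    refine hE _ (fun x hx => ?_) ?_
    · simp only [Finset.mem_insert] at hx
      rcases hx with rfl | rfl | hx
      exacts [ha, hb, hs _ hx]
    · rw [Finset.card_insert_of_notMem (by simp [hba.ne', has]),
        Finset.card_insert_of_notMem hbs, hc]
  have : 0 ≤ (id a - id b) * divDiff (insert a (insert b s)) id f :=
    mul_nonneg (sub_nonneg.2 hba.le) h0
  linarith

/-- Nonnegativity of all divided differences at `m + 3` points of a set `E` forces a function
to be, on the part of `E` in a compact interval with enough room on both sides, the product of
a polynomial and a Lipschitz function. -/
theorem abs_sub_le_of_divDiff_nonneg {m : ℕ} {E : Set ℝ} {f : ℝ → ℝ}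
    (hE : ∀ s : Finset ℝ, (∀ x ∈ s, x ∈ E) → s.card = m + 3 → 0 ≤ divDiff s id f)
    {a b l₁ l₂ r₁ r₂ : ℝ} {Z : Finset ℝ} (hZ : ∀ x ∈ Z, x ∈ E) (hZc : Z.card = m)
    (hZb : ∀ x ∈ Z, b < x) (hl₁ : l₁ ∈ E) (hl₂ : l₂ ∈ E) (hr₁ : r₁ ∈ E) (hr₂ : r₂ ∈ E)
    (hl : l₁ ≠ l₂) (hr : r₁ ≠ r₂) (hr₁Z : r₁ ∉ Z) (hr₂Z : r₂ ∉ Z)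
    (hl₁a : l₁ < a) (hl₂a : l₂ < a) (hbr₁ : b < r₁) (hbr₂ : b < r₂) :
    ∃ K : ℝ, ∀ y ∈ E, a ≤ y → y ≤ b → ∀ z ∈ E, a ≤ z → z ≤ b →
      |f y / ∏ j ∈ Z, (y - j) - f z / ∏ j ∈ Z, (z - j)| ≤ K * |y - z| := by
  -- For `y`, `z` at most `b` both `i - y` and `i - z` are at least `i - b > 0`, so `S` bounds the
  -- contribution of the nodes in `Z` uniformly.
  set S := ∑ i ∈ Z, |f i| / ((i - b) * ((i - b) * |∏ j ∈ Z.erase i, (i - j)|))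
  set dL := divDiff (insert l₁ (insert l₂ Z)) id f
  set dR := divDiff (insert r₁ (insert r₂ Z)) id f
  refine ⟨max |dL| |dR| + S, fun y hy hay hyb z hz haz hzb => ?_⟩
  rcases eq_or_ne y z with rfl | hyz
  · simp
  have hyZ : y ∉ Z := fun h => (hZb y h).not_ge hyb
  have hzZ : z ∉ Z := fun h => (hZb z h).not_ge hzb
  have hab : a ≤ b := hay.trans hyb
  have hl₁Z : l₁ ∉ Z := fun h => by linarith [hZb _ h]
  have hl₂Z : l₂ ∉ Z := fun h => by linarith [hZb _ h]
  have hins : ∀ {c}, c ∈ E → ∀ x ∈ insert c Z, x ∈ E := fun hc x hx => by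
    rcases Finset.mem_insert.1 hx with rfl | hx
    exacts [hc, hZ x hx]
  have hcard : ∀ {c}, c ∉ Z → (insert c Z).card = m + 1 := fun hc => by
    rw [Finset.card_insert_of_notMem hc, hZc]
  set d := divDiff (insert y (insert z Z)) id f with hd
  -- Move `y` down to `l₁`, then `z` down to `l₂`; the upper bound moves them up to `r₁` and `r₂`.
  have h1 : dL ≤ d := by
    have e1 := divDiff_insert_le_insert hE (hins hl₂) (hcard hl₂Z) (a := y) (b := l₁) hy hl₁
      (by simp [hyZ]; linarith) (by simp [hl₁Z, hl]) (by linarith)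
    have e2 := divDiff_insert_le_insert hE (hins hy) (hcard hyZ) (a := z) (b := l₂) hz hl₂
      (by simp [hzZ, hyz.symm]) (by simp [hl₂Z]; linarith) (by linarith)
    rw [Finset.insert_comm l₂ y, Finset.insert_comm z y] at e2
    exact e1.trans e2
  have h2 : d ≤ dR := by
    have e1 := divDiff_insert_le_insert hE (hins hz) (hcard hzZ) (a := r₁) (b := y) hr₁ hy
      (by simp [hr₁Z]; linarith) (by simp [hyZ, hyz]) (by linarith)
    have e2 := divDiff_insert_le_insert hE (hins hr₁) (hcard hr₁Z) (a := r₂) (b := z) hr₂ hz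
      (by simp [hr₂Z, hr.symm]) (by simp [hzZ]; linarith) (by linarith)
    rw [Finset.insert_comm z r₁, Finset.insert_comm r₂ r₁] at e2
    exact e1.trans e2
  have hdabs : |d| ≤ max |dL| |dR| := abs_le_max_abs_abs h1 h2
  have hSabs : |∑ i ∈ Z, f i / ((id i - id y) * ((id i - id z) * ∏ j ∈ Z.erase i, (id i - id j)))|
      ≤ S := by
    refine (Finset.abs_sum_le_sum_abs _ _).trans (Finset.sum_le_sum fun i hi => ?_)
    have hbi := hZb i hi
    have hprod : 0 < |∏ j ∈ Z.erase i, (i - j)| := abs_pos.2 (Finset.prod_ne_zero_iff.2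
      fun j hj => sub_ne_zero.2 (Finset.ne_of_mem_erase hj).symm)
    have : 0 < i - b := sub_pos.2 hbi
    have : 0 ≤ i - y := by linarith
    have : 0 ≤ i - z := by linarith
    simp only [id, abs_div, abs_mul]
    rw [abs_of_pos (show 0 < i - y by linarith), abs_of_pos (show 0 < i - z by linarith)]
    gcongr
  have hform := divDiff_insert_insert hyz hyZ hzZ id f
  rw [← hd] at hform
  have hyz' : y - z ≠ 0 := sub_ne_zero.2 hyz
  have key : f y / ∏ j ∈ Z, (y - j) - f z / ∏ j ∈ Z, (z - j) = (d -
      ∑ i ∈ Z, f i / ((id i - id y) * ((id i - id z) * ∏ j ∈ Z.erase i, (id i - id j)))) *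
        (y - z) := by
    rw [hform, add_sub_cancel_right]
    simp only [id]
    rw [← neg_sub y z]
    have hA : ∏ j ∈ Z, (y - j) ≠ 0 :=
      Finset.prod_ne_zero_iff.2 fun j hj => sub_ne_zero.2 fun h => hyZ (h ▸ hj)
    have hB : ∏ j ∈ Z, (z - j) ≠ 0 :=
      Finset.prod_ne_zero_iff.2 fun j hj => sub_ne_zero.2 fun h => hzZ (h ▸ hj)
    field_simp
    ring
  rw [key, abs_mul]
  gcongr
  exact (abs_sub _ _).trans (add_le_add hdabs hSabs)

/-- Auxiliary nodes from the same coset are chosen on both sides of `x`; the quotient by the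
polynomial with roots `Z` is Lipschitz between them, extends to `ℝ`, and is multiplied back. The
point `x` need not lie in the coset. -/
theorem exists_local_continuous_extension {m : ℕ} {I : Set ℝ} (hIo : IsOpen I)
    (hI : I.OrdConnected) {f : ℝ → ℝ} (hf : WrightConvexOn (m + 1) I f) (p : ℝ) {x : ℝ}
    (hx : x ∈ I) :
    ∃ ψ : ℝ → ℝ, ContinuousAt ψ x ∧ ∀ᶠ y in 𝓝 x, (∃ q : ℚ, y = p + q) → f y = ψ y := by
  obtain ⟨ε, hε, hball⟩ := Metric.isOpen_iff.1 hIo x hx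
  rw [Real.ball_eq_Ioo] at hball
  set E : Set ℝ := {y | (∃ q : ℚ, y = p + q) ∧ y ∈ I} with hEdef
  have hE : ∀ s : Finset ℝ, (∀ x ∈ s, x ∈ E) → s.card = m + 3 → 0 ≤ divDiff s id f :=
    fun s hs hc => divDiff_nonneg_of_mem_coset hI hf p s (fun x hx => (hs x hx).2)
      (fun x hx => (hs x hx).1) hc
  obtain ⟨R, hR, hRc⟩ := (infinite_coset_inter_Ioo p
    (show x + ε / 2 < x + ε by linarith)).exists_subset_card_eq (m + 2)
  obtain ⟨L, hL, hLc⟩ := (infinite_coset_inter_Ioo p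
    (show x - ε < x - ε / 2 by linarith)).exists_subset_card_eq 2
  obtain ⟨r₁, R', hr₁, rfl, hR'c⟩ := Finset.card_eq_succ.1 hRc
  obtain ⟨r₂, Z, hr₂, rfl, hZc⟩ := Finset.card_eq_succ.1 hR'c
  obtain ⟨l₁, l₂, hl, rfl⟩ := Finset.card_eq_two.1 hLc
  have hR' : ∀ y ∈ insert r₁ (insert r₂ Z), y ∈ E ∧ x + ε / 2 < y := fun y hy => by
    obtain ⟨h1, h2, h3⟩ := hR hy
    exact ⟨⟨h1, hball ⟨by linarith, by linarith⟩⟩, h2⟩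
  have hL' : ∀ y ∈ ({l₁, l₂} : Finset ℝ), y ∈ E ∧ y < x - ε / 2 := fun y hy => by
    obtain ⟨h1, h2, h3⟩ := hL hy
    exact ⟨⟨h1, hball ⟨by linarith, by linarith⟩⟩, h3⟩
  have hZ : ∀ y ∈ Z, y ∈ E ∧ x + ε / 2 < y := fun y hy => hR' y (by simp [hy])
  simp only [Finset.mem_insert, not_or] at hr₁
  obtain ⟨K, hK⟩ := abs_sub_le_of_divDiff_nonneg hE (a := x - ε / 2) (b := x + ε / 2)
    (fun y hy => (hZ y hy).1) hZc (fun y hy => (hZ y hy).2) (hL' l₁ (by simp)).1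
    (hL' l₂ (by simp)).1 (hR' r₁ (by simp)).1 (hR' r₂ (by simp)).1 hl hr₁.1 hr₁.2 hr₂
    (hL' l₁ (by simp)).2 (hL' l₂ (by simp)).2 (hR' r₁ (by simp)).2 (hR' r₂ (by simp)).2
  have hlip : LipschitzOnWith K.toNNReal (fun y => f y / ∏ j ∈ Z, (y - j))
      (E ∩ Set.Icc (x - ε / 2) (x + ε / 2)) := by
    refine LipschitzOnWith.of_dist_le_mul fun y hy z hz => ?_
    rw [Real.dist_eq, Real.dist_eq]
    refine (hK y hy.1 hy.2.1 hy.2.2 z hz.1 hz.2.1 hz.2.2).trans ?_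
    gcongr
    exact Real.le_coe_toNNReal K
  obtain ⟨φ, hφ, hφf⟩ := hlip.extend_real
  refine ⟨fun y => φ y * ∏ j ∈ Z, (y - j), ?_, ?_⟩
  · exact (hφ.continuous.mul (by fun_prop)).continuousAt
  · filter_upwards [Icc_mem_nhds (show x - ε / 2 < x by linarith) (show x < x + ε / 2 by linarith)]
      with y hy hyp
    have hyI : y ∈ I := hball ⟨by linarith [hy.1], by linarith [hy.2]⟩
    have hne : ∏ j ∈ Z, (y - j) ≠ 0 := Finset.prod_ne_zero_iff.2 fun j hj =>
      sub_ne_zero.2 fun h => by linarith [(hZ j hj).2, hy.2]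
    rw [← hφf ⟨⟨hyp, hyI⟩, hy⟩]
    exact (div_mul_cancel₀ _ hne).symm

theorem exists_continuousOn_extension {m : ℕ} {I : Set ℝ} (hIo : IsOpen I)
    (hI : I.OrdConnected) {f : ℝ → ℝ} (hf : WrightConvexOn (m + 1) I f) (p : ℝ) :
    ∃ g : ℝ → ℝ, ContinuousOn g I ∧ ∀ y ∈ I, (∃ q : ℚ, y = p + q) → f y = g y := by
  set A := I ∩ {y : ℝ | ∃ q : ℚ, y = p + q} with hA
  have hψ : ∀ x ∈ I, ∃ ψ : ℝ → ℝ, ContinuousAt ψ x ∧ f =ᶠ[𝓝[A] x] ψ := by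
    intro x hx
    obtain ⟨ψ, h1, h2⟩ := exists_local_continuous_extension hIo hI hf p hx
    refine ⟨ψ, h1, ?_⟩
    filter_upwards [mem_nhdsWithin_of_mem_nhds h2, self_mem_nhdsWithin] with y hy hyA
    exact hy hyA.2
  have hsub : I ⊆ closure A := (dense_coset p).open_subset_closure_inter hIo
  have hcont : ContinuousOn f A := fun x hx => by
    obtain ⟨ψ, h1, h2⟩ := hψ x hx.1
    exact h1.continuousWithinAt.congr_of_eventuallyEq h2 (h2.self_of_nhdsWithin hx)
  refine ⟨extendFrom A f, continuousOn_extendFrom hsub fun x hx => ?_, fun y hy hyp =>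
    (extendFrom_extends hcont y ⟨hy, hyp⟩).symm⟩
  obtain ⟨ψ, h1, h2⟩ := hψ x hx
  exact ⟨ψ x, (h1.tendsto.mono_left nhdsWithin_le_nhds).congr' h2.symm⟩

/-- Each point `p` is compared with the extension from its own coset. Different cosets may have
different extensions, so this does not make `f` continuous. -/
theorem tendsto_add_rat {m : ℕ} {I : Set ℝ} (hIo : IsOpen I)
    (hI : I.OrdConnected) {f : ℝ → ℝ} (hf : WrightConvexOn (m + 1) I f) {p : ℝ} (hp : p ∈ I) :
    Tendsto (fun r => f (p + r)) (𝓝[Set.range ((↑) : ℚ → ℝ)] 0) (𝓝 (f p)) := by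
  obtain ⟨ψ, h1, h2⟩ := exists_local_continuous_extension hIo hI hf p hp
  rw [h2.self_of_nhds ⟨0, by simp⟩]
  have ht : Tendsto (fun r : ℝ => p + r) (𝓝 0) (𝓝 p) := by
    have : ContinuousAt (fun r : ℝ => p + r) 0 := by fun_prop
    simpa [ContinuousAt] using this
  refine ((h1.tendsto.comp ht).mono_left nhdsWithin_le_nhds).congr' ?_
  filter_upwards [mem_nhdsWithin_of_mem_nhds (ht.eventually h2), self_mem_nhdsWithin]
    with r hr ⟨q, hq⟩
  exact (hr ⟨q, by rw [hq]⟩).symm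

theorem HigherConvexOn.of_coset {n : ℕ} {I : Set ℝ} (hIo : IsOpen I) {g : ℝ → ℝ}
    (hg : ContinuousOn g I) (p : ℝ)
    (h : ∀ s : Finset ℝ, (∀ x ∈ s, x ∈ I) → (∀ x ∈ s, ∃ q : ℚ, x = p + q) →
      s.card = n + 2 → 0 ≤ divDiff s id g) : HigherConvexOn n I g := by
  intro x hx hxI
  set D : Set (Fin (n + 2) → ℝ) := Set.pi Set.univ fun _ => {y : ℝ | ∃ q : ℚ, y = p + q}
  have hD : x ∈ closure D := by
    rw [closure_pi_set]
    exact fun i _ => dense_coset p (x i)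
  have : (𝓝[D] x).NeBot := mem_closure_iff_nhdsWithin_neBot.1 hD
  have hcont : ContinuousAt (fun y : Fin (n + 2) → ℝ => dividedDiff y g) x := by
    unfold dividedDiff
    refine tendsto_finsetSum _ fun i _ => ?_
    refine Tendsto.div ?_ ?_ ?_
    · exact ((hg.continuousAt (hIo.mem_nhds (hxI i))).tendsto).comp
        ((continuous_apply i).tendsto x)
    · exact Continuous.tendsto (by fun_prop) x
    · exact Finset.prod_ne_zero_iff.2 fun j hj =>
        sub_ne_zero.2 (hx.ne (Finset.ne_of_mem_erase hj).symm)
  refine ge_of_tendsto (hcont.tendsto.mono_left (nhdsWithin_le_nhds (s := D))) ?_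
  have hinj : ∀ᶠ y in 𝓝 x, ∀ i j, i ≠ j → y i ≠ y j := by
    refine eventually_all.2 fun i => eventually_all.2 fun j => ?_
    by_cases hij : i = j
    · simp [hij]
    · have : {y : Fin (n + 2) → ℝ | y i ≠ y j} ∈ 𝓝 x :=
        (isOpen_ne_fun (continuous_apply i) (continuous_apply j)).mem_nhds (hx.ne hij)
      filter_upwards [this] with y hy _ using hy
  have hmem : ∀ᶠ y in 𝓝 x, ∀ i, y i ∈ I :=
    eventually_all.2 fun i => (continuous_apply i).continuousAt (hIo.mem_nhds (hxI i))
  filter_upwards [mem_nhdsWithin_of_mem_nhds hinj, mem_nhdsWithin_of_mem_nhds hmem,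
    self_mem_nhdsWithin] with y h1 h2 h3
  have hy : Function.Injective y := fun i j hij => by
    by_contra hne
    exact h1 i j hne hij
  rw [dividedDiff_eq_divDiff hy]
  refine h _ ?_ ?_ (by rw [Finset.card_image_of_injective _ hy]; simp)
  · simpa using h2
  · simpa using fun i => h3 i (Set.mem_univ i)

theorem divDiff_congr {s : Finset ℝ} {f g v : ℝ → ℝ} (h : ∀ x ∈ s, f x = g x) :
    divDiff s v f = divDiff s v g :=
  Finset.sum_congr rfl fun i hi => by rw [h i hi]

/-! ### Calculus of iterated differences -/

theorem iterDiff_zero (h : Fin 0 → ℝ) (f : ℝ → ℝ) : iterDiff h f = f := by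
  simp [iterDiff]

theorem iterDiff_cons {n : ℕ} (a : ℝ) (h : Fin n → ℝ) (f : ℝ → ℝ) :
    iterDiff (Fin.cons a h : Fin (n + 1) → ℝ) f = fwdDiff a (iterDiff h f) := by
  simp [iterDiff, List.ofFn_succ]

theorem iterDiff_cons_apply {n : ℕ} (a : ℝ) (h : Fin n → ℝ) (f : ℝ → ℝ) (x : ℝ) :
    iterDiff (Fin.cons a h : Fin (n + 1) → ℝ) f x = iterDiff h f (x + a) - iterDiff h f x := by
  rw [iterDiff_cons, fwdDiff]

theorem iterDiff_comp_perm {n : ℕ} (σ : Equiv.Perm (Fin n)) (h : Fin n → ℝ) (f : ℝ → ℝ) :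
    iterDiff (h ∘ σ) f = iterDiff h f := by
  have : LeftCommutative (fwdDiff : ℝ → (ℝ → ℝ) → ℝ → ℝ) := ⟨fun a b f => by
    funext x
    simp only [fwdDiff, add_right_comm x b a]
    ring⟩
  exact (σ.ofFn_comp_perm h).foldr_eq f

theorem iterDiff_insertNth {n : ℕ} (i : Fin (n + 1)) (a : ℝ) (h : Fin n → ℝ) (f : ℝ → ℝ) :
    iterDiff (i.insertNth a h : Fin (n + 1) → ℝ) f =
      iterDiff (Fin.cons a h : Fin (n + 1) → ℝ) f := by
  rw [← Fin.insertNth_comp_cycleRange_symm i a h]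
  exact (iterDiff_comp_perm _ _ _).symm

theorem iterDiff_fwdDiff {n : ℕ} (a : ℝ) (h : Fin n → ℝ) (f : ℝ → ℝ) :
    iterDiff h (fwdDiff a f) = fwdDiff a (iterDiff h f) := by
  induction n with
  | zero => simp [iterDiff_zero]
  | succ n ih =>
    rw [← Fin.cons_self_tail h, iterDiff_cons, iterDiff_cons, ih]
    funext x
    simp only [fwdDiff, add_right_comm x a]
    ring

theorem iterDiff_sub {n : ℕ} (h : Fin n → ℝ) (f g : ℝ → ℝ) :
    iterDiff h (fun x => f x - g x) = fun x => iterDiff h f x - iterDiff h g x := by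
  induction n with
  | zero => simp [iterDiff_zero]
  | succ n ih =>
    rw [← Fin.cons_self_tail h, iterDiff_cons, iterDiff_cons, iterDiff_cons, ih]
    funext x
    simp only [fwdDiff]
    ring

theorem add_mem_of_add_sum_cons_mem {n : ℕ} {I : Set ℝ} (hI : I.OrdConnected)
    {a : ℝ} {h : Fin n → ℝ} (ha : 0 ≤ a) (hh : ∀ i, 0 < h i) {y : ℝ} (hy : y ∈ I)
    (hyh : y + ∑ i, (Fin.cons a h : Fin (n + 1) → ℝ) i ∈ I) :
    y + a ∈ I ∧ y + a + ∑ i, h i ∈ I ∧ y + ∑ i, h i ∈ I := by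
  have hs : 0 ≤ ∑ i, h i := Finset.sum_nonneg fun i _ => (hh i).le
  rw [Fin.sum_cons, ← add_assoc] at hyh
  exact ⟨hI.out hy hyh ⟨by linarith, by linarith⟩, hyh, hI.out hy hyh ⟨by linarith, by linarith⟩⟩

theorem tendsto_iterDiff {n : ℕ} {I : Set ℝ} (hI : I.OrdConnected) {f : ℝ → ℝ} {l : Filter ℝ}
    (hf : ∀ p ∈ I, Tendsto (fun r => f (p + r)) l (𝓝 (f p))) {h : Fin n → ℝ}
    (hh : ∀ i, 0 < h i) {y : ℝ} (hy : y ∈ I) (hyh : y + ∑ i, h i ∈ I) :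
    Tendsto (fun r => iterDiff h f (y + r)) l (𝓝 (iterDiff h f y)) := by
  induction n generalizing y with
  | zero => simpa [iterDiff_zero] using hf y hy
  | succ n ih =>
    obtain ⟨a, h, rfl⟩ : ∃ a h', h = (Fin.cons a h' : Fin (n + 1) → ℝ) :=
      ⟨_, _, (Fin.cons_self_tail h).symm⟩
    have ha : 0 < a := hh 0
    have hh' : ∀ i, 0 < h i := fun i => hh i.succ
    obtain ⟨h1, h2, h3⟩ := add_mem_of_add_sum_cons_mem hI ha.le hh' hy hyh
    simp only [iterDiff_cons_apply]
    refine ((ih hh' h1 h2).congr fun r => ?_).sub (ih hh' hy h3)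
    rw [add_right_comm]

theorem continuousAt_iff_tendsto_add {f : ℝ → ℝ} {p : ℝ} :
    ContinuousAt f p ↔ Tendsto (fun r => f (p + r)) (𝓝 0) (𝓝 (f p)) := by
  rw [ContinuousAt, ← map_add_left_nhds_zero p, tendsto_map'_iff]
  rfl

theorem exists_pos_forall_rat {P : ℝ → Prop}
    (h : ∀ᶠ r in 𝓝[Set.range ((↑) : ℚ → ℝ)] 0, P r) : (∃ r > 0, P r) ∧ ∃ r < 0, P r := by
  rw [eventually_nhdsWithin_iff, Metric.eventually_nhds_iff] at h
  obtain ⟨ε, hε, h⟩ := h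
  obtain ⟨q, hq, hqε⟩ := exists_rat_btwn hε
  refine ⟨⟨q, hq, h ?_ ⟨q, rfl⟩⟩, ⟨-q, by linarith, h ?_ ⟨-q, by simp⟩⟩⟩
  · rwa [Real.dist_eq, sub_zero, abs_of_pos hq]
  · rwa [Real.dist_eq, sub_zero, abs_neg, abs_of_pos hq]

/-! ### Continuity of differences of order `n`, vanishing of those of order `n + 1` -/

theorem WrightConvexOn.iterDiff_le {n : ℕ} {I : Set ℝ} {f : ℝ → ℝ} (hf : WrightConvexOn n I f)
    {h : Fin n → ℝ} (hh : ∀ i, 0 < h i) {u v : ℝ} (hu : u ∈ I) (hv : v + ∑ i, h i ∈ I)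
    (huv : u ≤ v) : iterDiff h f u ≤ iterDiff h f v := by
  rcases huv.eq_or_lt with rfl | huv
  · exact le_rfl
  have := hf (Fin.cons (v - u) h) (fun i => by
    refine Fin.cases ?_ (fun i => ?_) i
    · simpa using huv
    · simpa using hh i) u hu (by rwa [Fin.sum_cons, ← add_assoc, add_sub_cancel])
  rw [iterDiff_cons_apply, add_sub_cancel] at this
  linarith

/-- The difference is nondecreasing in the base point, so its values near `y` are squeezed between
values at `y + r` with `r` rational of either sign, and these tend to the value at `y`. -/
theorem continuousAt_iterDiff_of_wrightConvexOn {m : ℕ} {I : Set ℝ} (hIo : IsOpen I)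
    (hI : I.OrdConnected) {f : ℝ → ℝ} (hf : WrightConvexOn (m + 1) I f) {h : Fin (m + 1) → ℝ}
    (hh : ∀ i, 0 < h i) {y : ℝ} (hy : y ∈ I) (hyh : y + ∑ i, h i ∈ I) :
    ContinuousAt (iterDiff h f) y := by
  have ht := tendsto_iterDiff hI (fun p hp => tendsto_add_rat hIo hI hf hp) hh hy hyh
  have hev : ∀ᶠ z in 𝓝 y, z ∈ I ∧ z + ∑ i, h i ∈ I :=
    (hIo.eventually_mem hy).and ((hIo.preimage (by fun_prop)).mem_nhds hyh)
  have hadd : Tendsto (fun r : ℝ => y + r) (𝓝[Set.range ((↑) : ℚ → ℝ)] 0) (𝓝 y) := by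
    have : Continuous fun r : ℝ => y + r := by fun_prop
    simpa using (this.tendsto 0).mono_left
      (nhdsWithin_le_nhds (s := Set.range ((↑) : ℚ → ℝ)))
  refine tendsto_order.2 ⟨fun b hb => ?_, fun b hb => ?_⟩
  · obtain ⟨r, hr, hr1, hr2⟩ := (exists_pos_forall_rat
      ((ht.eventually (lt_mem_nhds hb)).and (hadd.eventually hev))).2
    filter_upwards [hev, lt_mem_nhds (show y + r < y by linarith)] with z hz hz'
    exact hr1.trans_le (hf.iterDiff_le hh hr2.1 hz.2 hz'.le)
  · obtain ⟨r, hr, hr1, hr2⟩ := (exists_pos_forall_rat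
      ((ht.eventually (gt_mem_nhds hb)).and (hadd.eventually hev))).1
    filter_upwards [hev, gt_mem_nhds (show y < y + r by linarith)] with z hz hz'
    exact (hf.iterDiff_le hh hz.1 hr2.2 hz'.le).trans_lt hr1

theorem continuousAt_iterDiff_of_continuousOn {n : ℕ} {I : Set ℝ} (hIo : IsOpen I)
    (hI : I.OrdConnected) {g : ℝ → ℝ} (hg : ContinuousOn g I) {h : Fin n → ℝ}
    (hh : ∀ i, 0 < h i) {y : ℝ} (hy : y ∈ I) (hyh : y + ∑ i, h i ∈ I) :
    ContinuousAt (iterDiff h g) y :=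
  continuousAt_iff_tendsto_add.2 (tendsto_iterDiff hI
    (fun _ hp => continuousAt_iff_tendsto_add.1 (hg.continuousAt (hIo.mem_nhds hp))) hh hy hyh)

theorem iterDiff_eq_zero_of_rat {n : ℕ} {I : Set ℝ} (hI : I.OrdConnected) {c : ℝ → ℝ} {p : ℝ}
    (hc : ∀ y ∈ I, (∃ q : ℚ, y = p + q) → c y = 0) {h : Fin n → ℝ} (hh : ∀ i, 0 < h i)
    (hq : ∀ i, ∃ q : ℚ, h i = q) {y : ℝ} (hy : y ∈ I) (hyh : y + ∑ i, h i ∈ I)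
    (hyp : ∃ q : ℚ, y = p + q) : iterDiff h c y = 0 := by
  induction n generalizing y with
  | zero => rw [iterDiff_zero]; exact hc y hy hyp
  | succ n ih =>
    obtain ⟨a, h, rfl⟩ : ∃ a h', h = (Fin.cons a h' : Fin (n + 1) → ℝ) :=
      ⟨_, _, (Fin.cons_self_tail h).symm⟩
    have ha : 0 < a := hh 0
    have hh' : ∀ i, 0 < h i := fun i => hh i.succ
    have hq' : ∀ i, ∃ q : ℚ, h i = q := fun i => hq i.succ
    obtain ⟨h1, h2, h3⟩ := add_mem_of_add_sum_cons_mem hI ha.le hh' hy hyh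
    obtain ⟨q, hq⟩ : ∃ q : ℚ, a = q := hq 0
    obtain ⟨r, hr⟩ := hyp
    rw [iterDiff_cons_apply, ih hh' hq' h1 h2 ⟨r + q, by push_cast; rw [hr, hq]; ring⟩,
      ih hh' hq' hy h3 ⟨r, hr⟩, sub_zero]

theorem eq_zero_of_continuousAt_of_dense {E : Set ℝ} (hE : Dense E) {φ : ℝ → ℝ} {t : ℝ}
    (hφ : ContinuousAt φ t) (h : ∀ᶠ s in 𝓝 t, s ∈ E → φ s = 0) : φ t = 0 := by
  have : (𝓝[E] t).NeBot := mem_closure_iff_nhdsWithin_neBot.1 (hE t)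
  refine tendsto_nhds_unique (hφ.tendsto.mono_left (nhdsWithin_le_nhds (s := E)))
    (tendsto_const_nhds.congr' ?_)
  filter_upwards [mem_nhdsWithin_of_mem_nhds h, self_mem_nhdsWithin] with s hs hsE
  exact (hs hsE).symm

/-- If all `n`-th order differences of `c` are continuous and `c` vanishes on a coset of `ℚ`, then
all differences of order `n + 1` vanish: they are symmetric and separately continuous in their
increments. -/
theorem iterDiff_succ_eq_zero {n : ℕ} {I : Set ℝ} (hIo : IsOpen I) (hI : I.OrdConnected)
    {c : ℝ → ℝ} {p : ℝ} (hc : ∀ y ∈ I, (∃ q : ℚ, y = p + q) → c y = 0)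
    (hcont : ∀ h : Fin n → ℝ, (∀ i, 0 < h i) → ∀ y ∈ I, y + ∑ i, h i ∈ I →
      ContinuousAt (iterDiff h c) y) (h : Fin (n + 1) → ℝ) (hh : ∀ i, 0 < h i) {y : ℝ}
    (hy : y ∈ I) (hyh : y + ∑ i, h i ∈ I) : iterDiff h c y = 0 := by
  -- `S` is the set of increments allowed to be irrational; the base point stays in the coset.
  have coset : ∀ (S : Finset (Fin (n + 1))) (h : Fin (n + 1) → ℝ), (∀ i, 0 < h i) →
      (∀ i ∉ S, ∃ q : ℚ, h i = q) → ∀ y ∈ I, y + ∑ i, h i ∈ I → (∃ q : ℚ, y = p + q) →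
      iterDiff h c y = 0 := by
    intro S
    induction S using Finset.induction_on with
    | empty =>
      intro h hh hq y hy hyh hyp
      exact iterDiff_eq_zero_of_rat hI hc hh (fun i => hq i (by simp)) hy hyh hyp
    | insert i S hiS ih =>
      intro h hh hq y hy hyh hyp
      obtain ⟨t, h, rfl⟩ : ∃ t h', h = (i.insertNth t h' : Fin (n + 1) → ℝ) :=
        ⟨_, _, (Fin.insertNth_self_removeNth i h).symm⟩
      have ht : 0 < t := by simpa using hh i
      have hh' : ∀ j, 0 < h j := fun j => by simpa using hh (i.succAbove j)
      have hsum : ∀ s, ∑ j, (i.insertNth s h : Fin (n + 1) → ℝ) j = s + ∑ j, h j := fun s => by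
        simp [Fin.sum_univ_succAbove _ i]
      rw [hsum, ← Fin.sum_cons] at hyh
      obtain ⟨h1, h2, h3⟩ := add_mem_of_add_sum_cons_mem hI ht.le hh' hy hyh
      refine eq_zero_of_continuousAt_of_dense (E := Set.range ((↑) : ℚ → ℝ))
        Rat.isDenseEmbedding_coe_real.dense
        (φ := fun s => iterDiff (i.insertNth s h : Fin (n + 1) → ℝ) c y) ?_ ?_
      -- By symmetry the varying increment may come first, and then `s` only shifts the base point
      -- of a difference of order `n`.
      · simp only [iterDiff_insertNth, iterDiff_cons_apply]
        refine ContinuousAt.sub ?_ continuousAt_const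
        exact ContinuousAt.comp (f := fun s => y + s) (hcont h hh' _ h1 h2) (by fun_prop)
      · have hcs : Continuous fun s : ℝ => y + s + ∑ j, h j := by fun_prop
        filter_upwards [lt_mem_nhds ht, (hIo.preimage hcs).mem_nhds h2] with s hs hsI
        rintro ⟨q, rfl⟩
        refine ih _ (fun j => ?_) (fun j hj => ?_) y hy ?_ hyp
        · refine Fin.succAboveCases i ?_ (fun j => ?_) j
          · simpa using hs
          · simpa using hh' j
        · rcases eq_or_ne j i with rfl | hji
          · exact ⟨q, by simp⟩
          · obtain ⟨k, rfl⟩ := Fin.exists_succAbove_eq hji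
            simpa using hq (i.succAbove k) (by simp [Fin.succAbove_ne, hj])
        · rw [hsum, ← add_assoc]
          exact hsI
  obtain ⟨a, h, rfl⟩ : ∃ a h', h = (Fin.cons a h' : Fin (n + 1) → ℝ) :=
    ⟨_, _, (Fin.cons_self_tail h).symm⟩
  have ha : 0 < a := hh 0
  have hh' : ∀ i, 0 < h i := fun i => hh i.succ
  obtain ⟨h1, h2, h3⟩ := add_mem_of_add_sum_cons_mem hI ha.le hh' hy hyh
  refine eq_zero_of_continuousAt_of_dense (dense_coset p) (φ := iterDiff _ c) ?_ ?_
  · have e : iterDiff (Fin.cons a h : Fin (n + 1) → ℝ) c =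
        fun x => iterDiff h c (x + a) - iterDiff h c x := funext (iterDiff_cons_apply a h c)
    rw [e]
    exact (ContinuousAt.comp (f := fun s => s + a) (hcont h hh' _ h1 h2) (by fun_prop)).sub
      (hcont h hh' _ hy h3)
  · have hcs : Continuous fun s : ℝ => s + ∑ i, (Fin.cons a h : Fin (n + 1) → ℝ) i := by fun_prop
    filter_upwards [hIo.mem_nhds hy, (hIo.preimage hcs).mem_nhds hyh] with s hs hs' hsp
    exact coset Finset.univ _ hh (fun i hi => absurd (Finset.mem_univ i) hi) s hs hs' hsp

/-! ### Increments of arbitrary sign -/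

/-- All partial sums `y + ∑ i ∈ S, h i` stay between two points of `I`. -/
def StepsIn {m : ℕ} (I : Set ℝ) (y : ℝ) (h : Fin m → ℝ) : Prop :=
  y + ∑ i, min (h i) 0 ∈ I ∧ y + ∑ i, max (h i) 0 ∈ I

theorem StepsIn.mono {m k : ℕ} {I : Set ℝ} (hI : I.OrdConnected) {y : ℝ} {h : Fin m → ℝ}
    {h' : Fin k → ℝ} (hh : StepsIn I y h) (h1 : ∑ i, min (h i) 0 ≤ ∑ i, min (h' i) 0)
    (h2 : ∑ i, max (h' i) 0 ≤ ∑ i, max (h i) 0) : StepsIn I y h' := by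
  have h3 : ∑ i, min (h' i) 0 ≤ ∑ i, max (h' i) 0 :=
    Finset.sum_le_sum fun i _ => min_le_max
  exact ⟨hI.out hh.1 hh.2 ⟨by linarith, by linarith⟩, hI.out hh.1 hh.2 ⟨by linarith, by linarith⟩⟩

/-- Since `Δ_{-a} f (y) = -Δ_a f (y - a)`, each negative increment costs a sign and a shift of the
base point; a zero increment kills both sides. -/
theorem iterDiff_eq_sign_mul {n : ℕ} (h : Fin n → ℝ) (f : ℝ → ℝ) (y : ℝ) :
    iterDiff h f y = (∏ i, (SignType.sign (h i) : ℝ)) *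
      iterDiff (fun i => |h i|) f (y + ∑ i, min (h i) 0) := by
  induction n generalizing y with
  | zero => simp [iterDiff_zero]
  | succ n ih =>
    obtain ⟨a, h, rfl⟩ : ∃ a h', h = (Fin.cons a h' : Fin (n + 1) → ℝ) :=
      ⟨_, _, (Fin.cons_self_tail h).symm⟩
    have e : (fun i => |(Fin.cons a h : Fin (n + 1) → ℝ) i|) =
        (Fin.cons |a| fun i => |h i| : Fin (n + 1) → ℝ) := by
      funext i
      refine Fin.cases ?_ (fun i => ?_) i <;> simp
    rw [e, iterDiff_cons_apply, iterDiff_cons_apply, ih h (y + a), ih h y,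
      Fin.prod_univ_succ, Fin.sum_univ_succ]
    simp only [Fin.cons_zero, Fin.cons_succ]
    rcases lt_trichotomy a 0 with ha | rfl | ha
    · rw [sign_neg ha, abs_of_neg ha, min_eq_left ha.le,
        show y + (a + ∑ i, min (h i) 0) + -a = y + ∑ i, min (h i) 0 by ring, ← add_assoc]
      simp only [SignType.coe_neg_one]
      ring
    · simp
    · rw [sign_pos ha, abs_of_pos ha, min_eq_right ha.le, zero_add, add_right_comm]
      simp only [SignType.coe_one]
      ring

theorem iterDiff_eq_zero_of_stepsIn {n : ℕ} {I : Set ℝ} {c : ℝ → ℝ}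
    (hc : ∀ h : Fin n → ℝ, (∀ i, 0 < h i) → ∀ y ∈ I, y + ∑ i, h i ∈ I → iterDiff h c y = 0)
    {h : Fin n → ℝ} {y : ℝ} (hh : StepsIn I y h) : iterDiff h c y = 0 := by
  rw [iterDiff_eq_sign_mul]
  by_cases h0 : ∃ i, h i = 0
  · obtain ⟨i, hi⟩ := h0
    rw [Finset.prod_eq_zero (Finset.mem_univ i) (by simp [hi]), zero_mul]
  · push Not at h0
    rw [hc _ (fun i => abs_pos.2 (h0 i)) _ hh.1, mul_zero]
    rw [add_assoc, ← Finset.sum_add_distrib]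
    convert hh.2 using 3 with i
    rcases le_total (h i) 0 with hi | hi
    · rw [min_eq_left hi, max_eq_right hi, abs_of_nonpos hi, add_neg_cancel]
    · rw [min_eq_right hi, max_eq_left hi, abs_of_nonneg hi, zero_add]

/-! ### The leading multiadditive form -/

section Leading

variable {n : ℕ} {I : Set ℝ} {c : ℝ → ℝ}

/-- The defect of additivity in the first increment is a difference of order `n + 2`. -/
theorem iterDiff_cons_add
    (hc : ∀ h : Fin (n + 2) → ℝ, (∀ i, 0 < h i) → ∀ y ∈ I, y + ∑ i, h i ∈ I → iterDiff h c y = 0)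
    {a b : ℝ} {h : Fin n → ℝ} {y : ℝ}
    (hh : StepsIn I y (Fin.cons a (Fin.cons b h : Fin (n + 1) → ℝ) : Fin (n + 2) → ℝ)) :
    iterDiff (Fin.cons (a + b) h : Fin (n + 1) → ℝ) c y =
      iterDiff (Fin.cons a h : Fin (n + 1) → ℝ) c y +
        iterDiff (Fin.cons b h : Fin (n + 1) → ℝ) c y := by
  have h0 := iterDiff_eq_zero_of_stepsIn hc hh
  simp only [iterDiff_cons_apply] at h0 ⊢
  rw [← add_assoc]
  linarith

theorem iterDiff_cons_natCast_mul (hI : I.OrdConnected)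
    (hc : ∀ h : Fin (n + 2) → ℝ, (∀ i, 0 < h i) → ∀ y ∈ I, y + ∑ i, h i ∈ I → iterDiff h c y = 0)
    {t : ℝ} {h : Fin n → ℝ} {y : ℝ} (N : ℕ)
    (hh : StepsIn I y (Fin.cons (N * t) h : Fin (n + 1) → ℝ)) :
    iterDiff (Fin.cons (N * t) h : Fin (n + 1) → ℝ) c y =
      N * iterDiff (Fin.cons t h : Fin (n + 1) → ℝ) c y := by
  induction N with
  | zero => simp [iterDiff_cons_apply]
  | succ N ih =>
    have hmin : min (((N + 1 : ℕ) : ℝ) * t) 0 = min (N * t) 0 + min t 0 := by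
      push_cast
      rcases le_total t 0 with ht | ht
      · rw [min_eq_left ht, min_eq_left (mul_nonpos_of_nonneg_of_nonpos (by positivity) ht),
          min_eq_left (mul_nonpos_of_nonneg_of_nonpos (by positivity) ht)]
        ring
      · rw [min_eq_right ht, min_eq_right (by positivity), min_eq_right (by positivity), add_zero]
    have hmax : max (((N + 1 : ℕ) : ℝ) * t) 0 = max (N * t) 0 + max t 0 := by
      push_cast
      rcases le_total t 0 with ht | ht
      · rw [max_eq_right ht, max_eq_right (mul_nonpos_of_nonneg_of_nonpos (by positivity) ht),
          max_eq_right (mul_nonpos_of_nonneg_of_nonpos (by positivity) ht), add_zero]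
      · rw [max_eq_left ht, max_eq_left (by positivity), max_eq_left (by positivity)]
        ring
    have h2 : StepsIn I y
        (Fin.cons (N * t) (Fin.cons t h : Fin (n + 1) → ℝ) : Fin (n + 2) → ℝ) := by
      refine hh.mono hI (le_of_eq ?_) (le_of_eq ?_)
      · rw [Fin.sum_univ_succ, Fin.sum_univ_succ, Fin.sum_univ_succ]
        simp only [Fin.cons_zero, Fin.cons_succ]
        rw [hmin, add_assoc]
      · rw [Fin.sum_univ_succ, Fin.sum_univ_succ, Fin.sum_univ_succ]
        simp only [Fin.cons_zero, Fin.cons_succ]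
        rw [hmax, add_assoc]
    have h3 : StepsIn I y (Fin.cons (N * t) h : Fin (n + 1) → ℝ) := by
      refine hh.mono hI ?_ ?_
      · rw [Fin.sum_univ_succ, Fin.sum_univ_succ]
        simp only [Fin.cons_zero, Fin.cons_succ]
        rw [hmin]
        linarith [min_le_right t 0]
      · rw [Fin.sum_univ_succ, Fin.sum_univ_succ]
        simp only [Fin.cons_zero, Fin.cons_succ]
        rw [hmax]
        linarith [le_max_right t 0]
    rw [show ((N + 1 : ℕ) : ℝ) * t = N * t + t by push_cast; ring, iterDiff_cons_add hc h2, ih h3]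
    push_cast
    ring

theorem min_le_min_div_natCast (a : ℝ) {N : ℕ} (hN : 1 ≤ N) : min a 0 ≤ min (a / N) 0 := by
  have : (1 : ℝ) ≤ N := by exact_mod_cast hN
  refine le_min ?_ (min_le_right _ _)
  rcases le_total a 0 with ha | ha
  · rw [min_eq_left ha, le_div_iff₀ (by positivity)]
    nlinarith
  · rw [min_eq_right ha]
    positivity

theorem max_div_natCast_le_max (a : ℝ) {N : ℕ} (hN : 1 ≤ N) : max (a / N) 0 ≤ max a 0 := by
  have : (1 : ℝ) ≤ N := by exact_mod_cast hN
  refine max_le ?_ (le_max_right _ _)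
  rcases le_total a 0 with ha | ha
  · rw [max_eq_right ha]
    exact div_nonpos_of_nonpos_of_nonneg ha (by positivity)
  · rw [max_eq_left ha]
    exact div_le_self ha this

/-- Each of the `n + 1` slots contributes one factor `N`. Dividing an increment by `N` shrinks the
range of the steps, so everything stays inside `I`. -/
theorem iterDiff_eq_pow_mul_iterDiff_div (hI : I.OrdConnected)
    (hc : ∀ h : Fin (n + 2) → ℝ, (∀ i, 0 < h i) → ∀ y ∈ I, y + ∑ i, h i ∈ I → iterDiff h c y = 0)
    {h : Fin (n + 1) → ℝ} {y : ℝ} (hh : StepsIn I y h) {N : ℕ} (hN : 1 ≤ N) :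
    iterDiff h c y = N ^ (n + 1) * iterDiff (fun i => h i / N) c y := by
  have hN0 : (N : ℝ) ≠ 0 := by positivity
  have key : ∀ S : Finset (Fin (n + 1)), iterDiff h c y =
      N ^ S.card * iterDiff (fun i => if i ∈ S then h i / N else h i) c y := by
    intro S
    induction S using Finset.induction_on with
    | empty => simp
    | insert i S hi ih =>
      rw [ih, Finset.card_insert_of_notMem hi, pow_succ, mul_assoc]
      congr 1
      set g : Fin (n + 1) → ℝ := fun i => if i ∈ S then h i / N else h i with hg
      have hgS : StepsIn I y g := by
        refine hh.mono hI (Finset.sum_le_sum fun j _ => ?_) (Finset.sum_le_sum fun j _ => ?_)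
        · simp only [hg]
          split_ifs
          exacts [min_le_min_div_natCast _ hN, le_rfl]
        · simp only [hg]
          split_ifs
          exacts [max_div_natCast_le_max _ hN, le_rfl]
      have e1 : g = i.insertNth (N * (h i / N)) (i.removeNth g) := by
        rw [mul_div_cancel₀ _ hN0]
        have : h i = g i := by simp [hg, hi]
        rw [this, Fin.insertNth_self_removeNth]
      have e2 : (fun j => if j ∈ insert i S then h j / N else h j) =
          i.insertNth (h i / N) (i.removeNth g) := by
        rw [Fin.insertNth_removeNth]
        funext j
        rcases eq_or_ne j i with rfl | hj
        · simp
        · simp [hj, hg]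
      have hgc : StepsIn I y (Fin.cons (N * (h i / N)) (i.removeNth g) : Fin (n + 1) → ℝ) := by
        rw [e1] at hgS
        refine hgS.mono hI (le_of_eq ?_) (le_of_eq ?_)
        · rw [Fin.sum_univ_succAbove _ i, Fin.sum_univ_succ]
          simp
        · rw [Fin.sum_univ_succ, Fin.sum_univ_succAbove _ i]
          simp
      rw [e2, iterDiff_insertNth, ← iterDiff_cons_natCast_mul hI hc N hgc, ← iterDiff_insertNth i,
        ← e1]
  simpa using key Finset.univ

theorem eventually_stepsIn_cons_div {m : ℕ} (hIo : IsOpen I) {y a : ℝ} (hy : y ∈ I)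
    (hya : y + a ∈ I) (w : Fin m → ℝ) :
    ∀ᶠ N : ℕ in atTop, StepsIn I y (Fin.cons a fun i => w i / N : Fin (m + 1) → ℝ) := by
  have hw : ∀ i, Tendsto (fun N : ℕ => w i / (N : ℝ)) atTop (𝓝 0) := fun i =>
    tendsto_const_div_atTop_nhds_zero_nat (w i)
  have h1 : Tendsto (fun N : ℕ => y + (min a 0 + ∑ i, min (w i / (N : ℝ)) 0)) atTop
      (𝓝 (y + (min a 0 + ∑ _i : Fin m, min (0 : ℝ) 0))) :=
    tendsto_const_nhds.add (tendsto_const_nhds.add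
      (tendsto_finsetSum _ fun i _ => (hw i).min tendsto_const_nhds))
  have h2 : Tendsto (fun N : ℕ => y + (max a 0 + ∑ i, max (w i / (N : ℝ)) 0)) atTop
      (𝓝 (y + (max a 0 + ∑ _i : Fin m, max (0 : ℝ) 0))) :=
    tendsto_const_nhds.add (tendsto_const_nhds.add
      (tendsto_finsetSum _ fun i _ => (hw i).max tendsto_const_nhds))
  simp only [min_self, max_self, Finset.sum_const_zero, add_zero] at h1 h2
  have hmin : y + min a 0 ∈ I := by rcases min_choice a 0 with h | h <;> simp [h, hy, hya]
  have hmax : y + max a 0 ∈ I := by rcases max_choice a 0 with h | h <;> simp [h, hy, hya]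
  filter_upwards [h1.eventually (hIo.eventually_mem hmin), h2.eventually (hIo.eventually_mem hmax)]
    with N hN1 hN2
  constructor
  · rw [Fin.sum_univ_succ]
    simpa using hN1
  · rw [Fin.sum_univ_succ]
    simpa using hN2

theorem eventually_stepsIn_div {m : ℕ} (hIo : IsOpen I) (hI : I.OrdConnected) {y : ℝ} (hy : y ∈ I)
    (w : Fin m → ℝ) : ∀ᶠ N : ℕ in atTop, StepsIn I y fun i => w i / N := by
  filter_upwards [eventually_stepsIn_cons_div hIo hy (a := 0) (by simpa using hy) w] with N hN
  refine hN.mono hI (le_of_eq ?_) (le_of_eq ?_)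
  · rw [Fin.sum_univ_succ]
    simp
  · rw [Fin.sum_univ_succ]
    simp

/-- Large increments leave `I`, so the form is defined by homogeneity from `h / N`. The scales `N`
and `N₀` are compared through `N * N₀`; the base points `y` and `y₀` through one more increment `y -
y₀`, whose difference vanishes. -/
theorem exists_leading_value (hIo : IsOpen I) (hI : I.OrdConnected) (hne : I.Nonempty)
    (hc : ∀ h : Fin (n + 2) → ℝ, (∀ i, 0 < h i) → ∀ y ∈ I, y + ∑ i, h i ∈ I → iterDiff h c y = 0)
    (h : Fin (n + 1) → ℝ) :
    ∃ v : ℝ, ∀ y ∈ I, ∀ᶠ N : ℕ in atTop, N ^ (n + 1) * iterDiff (fun i => h i / N) c y = v := by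
  obtain ⟨y₀, hy₀⟩ := hne
  obtain ⟨N₀, hN₀, hN₀1⟩ := ((eventually_stepsIn_div hIo hI hy₀ h).and (eventually_ge_atTop 1)).exists
  refine ⟨N₀ ^ (n + 1) * iterDiff (fun i => h i / N₀) c y₀, fun y hy => ?_⟩
  filter_upwards [eventually_ge_atTop 1, eventually_stepsIn_div hIo hI hy h,
    eventually_stepsIn_cons_div hIo hy₀ (a := y - y₀) (by simpa using hy) fun i => h i / N₀]
    with N hN1 hN hN'
  have h0 := iterDiff_eq_zero_of_stepsIn hc hN'
  rw [iterDiff_cons_apply, add_sub_cancel, sub_eq_zero] at h0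
  rw [iterDiff_eq_pow_mul_iterDiff_div hI hc hN₀ hN1, iterDiff_eq_pow_mul_iterDiff_div hI hc hN hN₀1,
    ← h0]
  simp only [div_right_comm _ (N : ℝ) (N₀ : ℝ)]
  ring

theorem insertNth_div {m : ℕ} (i : Fin (m + 1)) (a : ℝ) (h : Fin m → ℝ) (N : ℝ) :
    (fun j => (i.insertNth a h : Fin (m + 1) → ℝ) j / N) =
      (i.insertNth (a / N) fun j => h j / N : Fin (m + 1) → ℝ) := by
  funext j
  refine Fin.succAboveCases i ?_ (fun j => ?_) j <;> simp

/-- The symmetric multiadditive map given, for small increments, by the differences of order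
`n + 1` of a function whose differences of order `n + 2` vanish. -/
theorem exists_multilinearMap_eq_iterDiff (hIo : IsOpen I) (hI : I.OrdConnected)
    (hne : I.Nonempty)
    (hc : ∀ h : Fin (n + 2) → ℝ, (∀ i, 0 < h i) → ∀ y ∈ I, y + ∑ i, h i ∈ I →
      iterDiff h c y = 0) :
    ∃ B : MultilinearMap ℤ (fun _ : Fin (n + 1) => ℝ) ℝ,
      (∀ (σ : Equiv.Perm (Fin (n + 1))) (v : Fin (n + 1) → ℝ), B (fun i => v (σ i)) = B v) ∧
      ∀ h : Fin (n + 1) → ℝ, (∀ i, 0 < h i) → ∀ y ∈ I, y + ∑ i, h i ∈ I →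
        iterDiff h c y = B h := by
  choose V hV using exists_leading_value hIo hI hne hc
  obtain ⟨y₀, hy₀⟩ := hne
  have hadd : ∀ (i : Fin (n + 1)) (h : Fin n → ℝ) (a b : ℝ),
      V (i.insertNth (a + b) h) = V (i.insertNth a h) + V (i.insertNth b h) := by
    intro i h a b
    obtain ⟨N, h1, h2, h3, h4⟩ := ((hV (i.insertNth (a + b) h) y₀ hy₀).and
      ((hV (i.insertNth a h) y₀ hy₀).and ((hV (i.insertNth b h) y₀ hy₀).and
      (eventually_stepsIn_div hIo hI hy₀
        (Fin.cons a (Fin.cons b h : Fin (n + 1) → ℝ) : Fin (n + 2) → ℝ))))).exists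
    rw [insertNth_div, iterDiff_insertNth] at h1 h2 h3
    have e : (fun i => (Fin.cons a (Fin.cons b h : Fin (n + 1) → ℝ) : Fin (n + 2) → ℝ) i / (N : ℝ))
        = (Fin.cons (a / N) (Fin.cons (b / N) fun i => h i / N : Fin (n + 1) → ℝ) :
          Fin (n + 2) → ℝ) := by
      simp only [← Fin.insertNth_zero', insertNth_div]
    rw [e] at h4
    rw [← h1, ← h2, ← h3, add_div, iterDiff_cons_add hc h4, mul_add]
  have hsmul : ∀ (i : Fin (n + 1)) (h : Fin n → ℝ) (k : ℤ) (a : ℝ),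
      V (i.insertNth (k • a) h) = k • V (i.insertNth a h) := fun i h k a =>
    (AddMonoidHom.mk' (fun a => V (i.insertNth a h)) (hadd i h)).map_zsmul k a
  refine ⟨⟨V, ?_, ?_⟩, fun σ v => ?_, fun h hh y hy hyh => ?_⟩
  · intro inst v i a b
    rw [Subsingleton.elim inst (instDecidableEqFin _), ← Fin.insertNth_removeNth,
      ← Fin.insertNth_removeNth, ← Fin.insertNth_removeNth]
    exact hadd i _ a b
  · intro inst v i k a
    rw [Subsingleton.elim inst (instDecidableEqFin _), ← Fin.insertNth_removeNth,
      ← Fin.insertNth_removeNth]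
    exact hsmul i _ k a
  · obtain ⟨N, h1, h2⟩ := ((hV (fun i => v (σ i)) y₀ hy₀).and (hV v y₀ hy₀)).exists
    change V (fun i => v (σ i)) = V v
    rw [← h1, ← h2]
    congr 1
    exact congrFun (iterDiff_comp_perm σ (fun i => v i / (N : ℝ)) c) y₀
  · obtain ⟨N, h1, h2⟩ := ((hV h y hy).and (eventually_ge_atTop 1)).exists
    have : StepsIn I y h := by
      constructor
      · rw [Finset.sum_eq_zero fun i _ => min_eq_right (hh i).le]
        simpa using hy
      · rw [Finset.sum_congr rfl fun i _ => max_eq_left (hh i).le]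
        exact hyh
    rw [iterDiff_eq_pow_mul_iterDiff_div hI hc this h2]
    exact h1

end Leading

/-! ### Polarization and the local Fréchet theorem -/

/-- Telescoping: the arguments are shifted by `t` one at a time, so in the `i`-th term those before
`i` are already shifted. -/
theorem MultilinearMap.map_add_const_sub {m : ℕ}
    (B : MultilinearMap ℤ (fun _ : Fin (m + 1) => ℝ) ℝ) (w : Fin (m + 1) → ℝ) (t : ℝ) :
    B (fun j => w j + t) - B w = ∑ i : Fin (m + 1), B (i.insertNth t fun j =>
      w (i.succAbove j) + if (i.succAbove j : ℕ) < i then t else 0) := by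
  have h := Finset.sum_range_sub (fun k : ℕ => B fun j => w j + if (j : ℕ) < k then t else 0)
    (m + 1)
  rw [Finset.sum_range] at h
  have e1 : (fun j : Fin (m + 1) => w j + if (j : ℕ) < m + 1 then t else 0) = fun j => w j + t := by
    funext j
    simp [j.isLt]
  simp only [e1, Nat.not_lt_zero, if_false, add_zero] at h
  rw [← h]
  refine Finset.sum_congr rfl fun i _ => ?_
  set v : Fin (m + 1) → ℝ := fun j => w j + if (j : ℕ) < i then t else 0 with hv
  have e2 : (fun j : Fin (m + 1) => w j + if (j : ℕ) < (i : ℕ) + 1 then t else 0) =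
      Function.update v i (w i + t) := by
    funext j
    rcases eq_or_ne j i with rfl | hj
    · simp
    · have : (j : ℕ) ≠ i := fun h => hj (Fin.ext h)
      have : (j : ℕ) < i + 1 ↔ (j : ℕ) < i := by omega
      simp [hj, hv, this]
  have e3 : v = Function.update v i (w i) := by
    rw [eq_comm, Function.update_eq_self_iff]
    simp [hv]
  rw [e2, B.map_update_add, ← e3, add_sub_cancel_left, ← Fin.insertNth_removeNth]
  rfl

theorem iterDiff_sum {ι : Type*} {n : ℕ} (h : Fin n → ℝ) (s : Finset ι) (f : ι → ℝ → ℝ) (x : ℝ) :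
    iterDiff h (fun y => ∑ i ∈ s, f i y) x = ∑ i ∈ s, iterDiff h (f i) x := by
  induction n generalizing x with
  | zero => simp [iterDiff_zero]
  | succ n ih =>
    rw [← Fin.cons_self_tail h, iterDiff_cons_apply, ih, ih, ← Finset.sum_sub_distrib]
    simp only [iterDiff_cons_apply]

/-- Polarization, with arbitrary shifts of the arguments. -/
theorem iterDiff_multilinearMap {m : ℕ} (B : MultilinearMap ℤ (fun _ : Fin m => ℝ) ℝ)
    (hB : ∀ (σ : Equiv.Perm (Fin m)) (v : Fin m → ℝ), B (fun i => v (σ i)) = B v)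
    (h a : Fin m → ℝ) (y : ℝ) :
    iterDiff h (fun x => B fun i => x + a i) y = m.factorial * B h := by
  induction m generalizing y with
  | zero =>
    rw [iterDiff_zero, Nat.factorial_zero, Nat.cast_one, one_mul]
    exact congrArg B (Subsingleton.elim _ _)
  | succ m ih =>
    obtain ⟨t, h, rfl⟩ : ∃ t h', h = (Fin.cons t h' : Fin (m + 1) → ℝ) :=
      ⟨_, _, (Fin.cons_self_tail h).symm⟩
    have hsymm : ∀ (σ : Equiv.Perm (Fin m)) (v : Fin m → ℝ),
        B.curryLeft t (fun i => v (σ i)) = B.curryLeft t v := by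
      intro σ v
      refine (congrArg B ?_).trans (hB (Equiv.Perm.decomposeFin.symm (0, σ)) (Fin.cons t v))
      funext i
      refine Fin.cases ?_ (fun i => ?_) i <;> simp
    have hinsert : ∀ (i : Fin (m + 1)) (v : Fin m → ℝ),
        B (i.insertNth t v) = B.curryLeft t v := by
      intro i v
      rw [MultilinearMap.curryLeft_apply, ← hB i.cycleRange (Fin.cons t v)]
      exact congrArg B (Fin.cons_comp_cycleRange t v i).symm
    -- One difference leaves `m + 1` terms with the same form `B.curryLeft t` but different shifts,
    -- which is why the induction carries arbitrary shifts `a`.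
    have hdiff : fwdDiff t (fun x => B fun i => x + a i) = fun x => ∑ i : Fin (m + 1),
        B.curryLeft t fun j =>
          x + (a (i.succAbove j) + if (i.succAbove j : ℕ) < i then t else 0) := by
      funext x
      have := B.map_add_const_sub (fun i => x + a i) t
      simp only [add_right_comm x _ t, hinsert, add_assoc x (a _)] at this
      simp only [fwdDiff]
      exact this
    rw [iterDiff_cons, ← iterDiff_fwdDiff, hdiff, iterDiff_sum,
      Finset.sum_congr rfl fun i _ => ih (B.curryLeft t) hsymm h _ y]
    simp only [Finset.sum_const, Finset.card_univ, Fintype.card_fin, nsmul_eq_mul,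
      MultilinearMap.curryLeft_apply, Nat.factorial_succ]
    push_cast
    ring

theorem IsPolynomialFunction.const (n : ℕ) (a : ℝ) : IsPolynomialFunction n fun _ => a :=
  ⟨a, fun _ => 0, by simp, by simp⟩

theorem IsPolynomialFunction.add_diagonal {n : ℕ} {P : ℝ → ℝ} (hP : IsPolynomialFunction n P)
    {B : MultilinearMap ℤ (fun _ : Fin (n + 1) => ℝ) ℝ}
    (hB : ∀ (σ : Equiv.Perm (Fin (n + 1))) (v : Fin (n + 1) → ℝ), B (fun i => v (σ i)) = B v) :
    IsPolynomialFunction (n + 1) fun x => P x + B fun _ => x := by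
  obtain ⟨a₀, A, hA, hPA⟩ := hP
  refine ⟨a₀, Function.update A (n + 1) B, fun k => ?_, fun x => ?_⟩
  · rcases eq_or_ne k (n + 1) with rfl | hk
    · simpa using hB
    · simpa [Function.update_of_ne hk] using hA k
  · rw [Finset.sum_Icc_succ_top (by omega), Function.update_self, ← add_assoc]
    refine congrArg (· + _) ((hPA x).trans (congrArg _ (Finset.sum_congr rfl fun k hk => ?_)))
    rw [Function.update_of_ne (by have := (Finset.mem_Icc.1 hk).2; omega)]

/-- Induction on the degree: by polarization, subtracting the diagonal of the leading form divided
by `(n + 1)!` kills the differences of order `n + 1`. -/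
theorem exists_isPolynomialFunction {I : Set ℝ} (hIo : IsOpen I) (hI : I.OrdConnected) (n : ℕ)
    (c : ℝ → ℝ) (hc : ∀ h : Fin (n + 1) → ℝ, (∀ i, 0 < h i) → ∀ y ∈ I, y + ∑ i, h i ∈ I →
      iterDiff h c y = 0) :
    ∃ P, IsPolynomialFunction n P ∧ ∀ x ∈ I, c x = P x := by
  rcases I.eq_empty_or_nonempty with rfl | hne
  · exact ⟨_, IsPolynomialFunction.const n 0, by simp⟩
  induction n generalizing c with
  | zero =>
    obtain ⟨y₀, hy₀⟩ := hne
    have hlt : ∀ x ∈ I, ∀ y ∈ I, x < y → c y = c x := fun x hx y hy hxy => by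
      have := hc (Fin.cons (y - x) Fin.elim0) (fun i => by
        fin_cases i
        simpa using hxy) x hx (by simpa using hy)
      rw [iterDiff_cons_apply, iterDiff_zero, add_sub_cancel] at this
      linarith
    refine ⟨_, IsPolynomialFunction.const 0 (c y₀), fun x hx => ?_⟩
    rcases lt_trichotomy x y₀ with h | rfl | h
    exacts [(hlt x hx y₀ hy₀ h).symm, rfl, hlt y₀ hy₀ x hx h]
  | succ n ih =>
    obtain ⟨B, hB, hBc⟩ := exists_multilinearMap_eq_iterDiff hIo hI hne hc
    obtain ⟨A, hAB⟩ : ∃ A : MultilinearMap ℤ (fun _ : Fin (n + 1) => ℝ) ℝ,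
        ∀ v, A v = 1 / ((n + 1).factorial : ℝ) * B v := ⟨(1 / ((n + 1).factorial : ℝ)) • B, fun _ => rfl⟩
    have hA : ∀ (σ : Equiv.Perm (Fin (n + 1))) (v : Fin (n + 1) → ℝ),
        A (fun i => v (σ i)) = A v := fun σ v => by
      rw [hAB, hAB, hB]
    obtain ⟨P, hP, hPc⟩ := ih (fun x => c x - A fun _ => x) fun h hh y hy hyh => by
      have hp := iterDiff_multilinearMap A hA h (fun _ => 0) y
      simp only [add_zero] at hp
      rw [iterDiff_sub]
      have hfac : ((n + 1).factorial : ℝ) ≠ 0 := by positivity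
      simp only [hp]
      rw [hBc h hh y hy hyh, hAB, ← mul_assoc, mul_one_div_cancel hfac, one_mul, sub_self]
    exact ⟨_, hP.add_diagonal hA, fun x hx => by rw [← hPc x hx]; ring⟩

theorem theorem1 (n : ℕ) (I : Set ℝ) (hI_open : IsOpen I) (hI_interval : I.OrdConnected)
    (f : ℝ → ℝ) (hf : WrightConvexOn n I f) :
    ∃ g P : ℝ → ℝ, HigherConvexOn n I g ∧ IsPolynomialFunction n P ∧
      ∀ x ∈ I, f x = g x + P x := by
  rcases n with _ | m
  · refine ⟨f, fun _ => 0, fun x hx hxI => ?_, IsPolynomialFunction.const 0 0, by simp⟩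
    have hmono : ∀ u ∈ I, ∀ v ∈ I, u ≤ v → f u ≤ f v := fun u hu v hv huv => by
      simpa [iterDiff_zero] using
        hf.iterDiff_le (h := Fin.elim0) (fun i => i.elim0) hu (by simpa using hv) huv
    have hne : x 0 ≠ x 1 := hx.ne (by simp)
    have e0 : Finset.univ.erase (0 : Fin (0 + 2)) = {1} := by decide
    have e1 : Finset.univ.erase (1 : Fin (0 + 2)) = {0} := by decide
    have e : dividedDiff x f = (f (x 0) - f (x 1)) / (x 0 - x 1) := by
      have h1 := sub_ne_zero.2 hne
      have h2 := sub_ne_zero.2 hne.symm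
      unfold dividedDiff
      rw [Fin.sum_univ_two, e0, e1, Finset.prod_singleton, Finset.prod_singleton,
        ← neg_sub (x 0) (x 1)]
      field_simp
      ring
    rw [e]
    rcases le_total (x 0) (x 1) with h | h
    · exact div_nonneg_of_nonpos (sub_nonpos.2 (hmono _ (hxI 0) _ (hxI 1) h)) (sub_nonpos.2 h)
    · exact div_nonneg (sub_nonneg.2 (hmono _ (hxI 1) _ (hxI 0) h)) (sub_nonneg.2 h)
  -- The coset is `ℚ` itself, that is, `p = 0`.
  · obtain ⟨g, hg, hgf⟩ := exists_continuousOn_extension hI_open hI_interval hf 0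
    obtain ⟨P, hP, hPc⟩ := exists_isPolynomialFunction hI_open hI_interval (m + 1)
      (fun x => f x - g x) fun h hh y hy hyh =>
        iterDiff_succ_eq_zero hI_open hI_interval (p := 0)
          (fun z hz hzq => sub_eq_zero.2 (hgf z hz hzq))
          (fun h hh y hy hyh => by
            rw [iterDiff_sub]
            exact (continuousAt_iterDiff_of_wrightConvexOn hI_open hI_interval hf hh hy hyh).sub
              (continuousAt_iterDiff_of_continuousOn hI_open hI_interval hg hh hy hyh))
          h hh hy hyh
    refine ⟨g, P, HigherConvexOn.of_coset hI_open hg 0 fun s hsI hsq hsc => ?_, hP,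
      fun x hx => by rw [← hPc x hx]; ring⟩
    rw [← divDiff_congr fun x hx => hgf x (hsI x hx) (hsq x hx)]
    exact divDiff_nonneg_of_mem_coset hI_interval hf 0 s hsI hsq hsc
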